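/- A thin Lie algebra over a field $F$ is a Lie algebra $L=\bigoplus_{i\ge 1}L_i$ over $F$, graded over the positive integers and generated by $L_1$, such that $\dim_F L_1=2$ and the covering property holds: $[u,L_1]=L_{i+1}$ for every $i\ge 1$ and every nonzero $u\in L_i$. Let $F$ be a field of positive characteristic which has a field extension of degree $2$. Then the number of isomorphism classes of thin Lie algebras $L$ over $F$ such that $\dim_F L_i=2$ for every $i\ge 3$ equals $|F|^{\aleph_0}$. This is the maximum possible: the number of isomorphism classes of all thin Lie algebras over $F$ is at most $|F|^{\aleph_0}$. Moreover, there is a non-metabelian thin Lie algebra $L$ over $F$ such that $\dim_F L_i=2$ for every $i\ge 3$. -/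

import Mathlib

open scoped Cardinal

universe u v

/-- A grading `L = ⨁_{i ≥ 1} L_i` of the Lie algebra `L` over the positive integers (the index `0`
is present only for convenience, `L_0 = 0`) that makes `L` a thin Lie algebra: `L` is generated by
`L_1`, `dim L_1 = 2`, and the covering property holds: `[u, L_1] = L_{i+1}` for every `i ≥ 1` and
every nonzero `u ∈ L_i`. -/
structure IsThinGrading {F : Type u} [Field F] {L : Type v} [LieRing L] [LieAlgebra F L]
    (𝒜 : ℕ → Submodule F L) : Prop where
  isInternal : DirectSum.IsInternal 𝒜
  zero_eq : 𝒜 0 = ⊥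
  lie_mem : ∀ i j : ℕ, ∀ a ∈ 𝒜 i, ∀ b ∈ 𝒜 j, ⁅a, b⁆ ∈ 𝒜 (i + j)
  generated : LieSubalgebra.lieSpan F L (𝒜 1 : Set L) = ⊤
  finrank_one : Module.finrank F (𝒜 1) = 2
  covering : ∀ i : ℕ, 1 ≤ i → ∀ a ∈ 𝒜 i, a ≠ 0 →
    (𝒜 1).map (LieAlgebra.ad F L a) = 𝒜 (i + 1)

/-- A Lie algebra over the field `F`, as a bundled object. -/
structure LieAlgOver (F : Type u) [Field F] : Type (u + 1) where
  carrier : Type u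
  [lieRing : LieRing carrier]
  [lieAlgebra : LieAlgebra F carrier]

attribute [instance] LieAlgOver.lieRing LieAlgOver.lieAlgebra

namespace LieAlgOver

/-- `L` carries a thin grading. -/
def IsThin {F : Type u} [Field F] (L : LieAlgOver F) : Prop :=
  ∃ 𝒜 : ℕ → Submodule F L.carrier, IsThinGrading 𝒜

/-- `L` carries a thin grading in which every component of degree at least `3` has
dimension `2`. -/
def IsThinOfDimTwo {F : Type u} [Field F] (L : LieAlgOver F) : Prop :=
  ∃ 𝒜 : ℕ → Submodule F L.carrier,
    IsThinGrading 𝒜 ∧ ∀ i : ℕ, 3 ≤ i → Module.finrank F (𝒜 i) = 2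

/-- `L` is metabelian: its second derived algebra `[[L, L], [L, L]]` vanishes. -/
def IsMetabelian {F : Type u} [Field F] (L : LieAlgOver F) : Prop :=
  LieAlgebra.derivedSeries F L.carrier 2 = ⊥

/-- Isomorphism of Lie algebras over `F`. -/
def isoSetoid (F : Type u) [Field F] : Setoid (LieAlgOver F) where
  r A B := Nonempty (A.carrier ≃ₗ⁅F⁆ B.carrier)
  iseqv :=
    { refl := fun _ => ⟨LieEquiv.refl⟩
      symm := fun ⟨e⟩ => ⟨e.symm⟩
      trans := fun ⟨e⟩ ⟨f⟩ => ⟨e.trans f⟩ }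

/-- The number of isomorphism classes of Lie algebras over `F` that contain an algebra with the
property `P`. -/
noncomputable def numIsoClasses {F : Type u} [Field F] (P : LieAlgOver F → Prop) :
    Cardinal.{u + 1} :=
  #{c : Quotient (isoSetoid F) // ∃ L : LieAlgOver F, P L ∧ Quotient.mk (isoSetoid F) L = c}

end LieAlgOver

/-! Lower bound. Let `E` be quadratic over `F` and let `μ` be a sequence in `E` with `μ 0 = 0` and
`μ i ∉ F` for `i > 0`, not eventually constant. Inside the upper triangular matrices over `E`, let
`x` be the plain shift and `y` the shift with weight `μ (1 + v_p (m + 1))` at position `m`. The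
function `coeffFun`, built digit by digit in base `p` from binomial coefficients, satisfies
`coeffFun_comm`: bracketing `e * coeffFun k` with `a x + b y` gives `(a + b * μ i) * e * coeffFun (k
+ 1)`, where `i = centIdx k`. For `k ≥ 1` we have `μ i ∉ F`, so `(a, b) ↦ a + b * μ i` is a
bijection from `F × F` to `E`. This is the covering property with two-dimensional components from
degree 3 on, and `μ` is recorded in the action of `y`.

An isomorphism need not respect gradings, but it respects the superdiagonal filtration, so leading
diagonals can be compared. If `μ (i+1) = w + s i` and `ν (i+1) = w + s' i` with `s, s'` in `F`, the
comparison yields one fractional linear relation between `s` and `s'`, valid for all `i`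
(`exists_relation`). Fixing the first three terms forces `s = s'` (`eq_of_relation`), so sequences
in `F` inject into isomorphism classes. These algebras are also non-metabelian, since `μ 1 ≠ μ 2`.

Upper bound. A finitely generated Lie algebra has a countable basis, hence is determined by
countably many structure constants. -/

namespace ThinLie

/-! ### Self-similar coefficients in characteristic `p` -/

section Combinatorics

variable (p : ℕ) {E : Type*} [Field E]

/-- The weight at position `m + 1` and level `l` attached to the sequence `μ`. -/
def weight (μ : ℕ → E) (l m : ℕ) : E := μ (l + 1 + padicValNat p (m + 1))

/-- The coefficient at position `m + 1` of the homogeneous element of degree `k + 1`, at level `l`,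
of the algebra attached to the sequence `μ`. -/
def coeffFun [hp : Fact p.Prime] (μ : ℕ → E) (l k m : ℕ) : E :=
  if _ : k = 0 then weight p μ l m - μ l
  else ((p - 1 - k % p + (p - 1 - m % p)).choose (p - 1 - k % p) : E) *
    coeffFun μ (l + 1) (k / p) (m / p)
termination_by k
decreasing_by exact Nat.div_lt_self (Nat.pos_of_ne_zero ‹_›) hp.out.one_lt

/-- The index of the two-step centralizer of the component of degree `k + 1` at level `l`. -/
def centIdx [hp : Fact p.Prime] (l k : ℕ) : ℕ :=
  if _ : k = 0 then l
  else if p ∣ k + 1 then centIdx (l + 1) (k / p) else l + 1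
termination_by k
decreasing_by exact Nat.div_lt_self (Nat.pos_of_ne_zero ‹_›) hp.out.one_lt

variable {p}

theorem exists_mul_add (hp0 : 0 < p) (m : ℕ) : ∃ n t, t < p ∧ m = p * n + t :=
  ⟨m / p, m % p, Nat.mod_lt _ hp0, (Nat.div_add_mod m p).symm⟩

variable [hp : Fact p.Prime]

omit hp [Field E] in
theorem weight_of_lt (μ : ℕ → E) (l n : ℕ) {t : ℕ} (ht : t + 1 < p) :
    weight p μ l (p * n + t) = μ (l + 1) := by
  have : ¬ p ∣ p * n + t + 1 := by
    rw [add_assoc, Nat.dvd_add_right (dvd_mul_right p n)]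
    exact Nat.not_dvd_of_pos_of_lt (Nat.succ_pos _) ht
  rw [weight, padicValNat.eq_zero_of_not_dvd this, add_zero]

omit [Field E] in
theorem weight_of_eq (μ : ℕ → E) (l n : ℕ) {t : ℕ} (ht : t + 1 = p) :
    weight p μ l (p * n + t) = weight p μ (l + 1) n := by
  have : p * n + t + 1 = p * (n + 1) := by rw [add_assoc, ht, mul_add, mul_one]
  rw [weight, weight, this, padicValNat.mul hp.out.ne_zero (Nat.succ_ne_zero n), padicValNat_self]
  congr 1; ring

theorem coeffFun_zero (μ : ℕ → E) (l m : ℕ) : coeffFun p μ l 0 m = weight p μ l m - μ l := by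
  rw [coeffFun]; simp

theorem coeffFun_mul_add (μ : ℕ → E) (l j n : ℕ) {r t : ℕ} (hr : r < p) (ht : t < p)
    (h0 : p * j + r ≠ 0) :
    coeffFun p μ l (p * j + r) (p * n + t) =
      ((p - 1 - r + (p - 1 - t)).choose (p - 1 - r) : E) * coeffFun p μ (l + 1) j n := by
  have hp0 := hp.out.pos
  rw [coeffFun, dif_neg h0, Nat.mul_add_mod, Nat.mul_add_mod, Nat.mod_eq_of_lt hr,
    Nat.mod_eq_of_lt ht, Nat.mul_add_div hp0, Nat.mul_add_div hp0, Nat.div_eq_of_lt hr,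
    Nat.div_eq_of_lt ht, add_zero, add_zero]

theorem centIdx_zero (l : ℕ) : centIdx p l 0 = l := by
  rw [centIdx]; simp

theorem centIdx_of_lt (l j : ℕ) {r : ℕ} (hr : r + 1 < p) (h0 : p * j + r ≠ 0) :
    centIdx p l (p * j + r) = l + 1 := by
  have : ¬ p ∣ p * j + r + 1 := by
    rw [add_assoc, Nat.dvd_add_right (dvd_mul_right p j)]
    exact Nat.not_dvd_of_pos_of_lt (Nat.succ_pos _) hr
  rw [centIdx, dif_neg h0, if_neg this]

theorem centIdx_of_eq (l j : ℕ) {r : ℕ} (hr : r + 1 = p) :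
    centIdx p l (p * j + r) = centIdx p (l + 1) j := by
  have h1 := hp.out.one_lt
  have : p ∣ p * j + r + 1 := ⟨j + 1, by rw [add_assoc, hr, mul_add, mul_one]⟩
  rw [centIdx, dif_neg (by omega), if_pos this, Nat.mul_add_div hp.out.pos,
    Nat.div_eq_of_lt (by omega), add_zero]

theorem le_centIdx (l k : ℕ) : l ≤ centIdx p l k := by
  induction k using Nat.strong_induction_on generalizing l with
  | _ k ih =>
    rcases Nat.eq_zero_or_pos k with rfl | hk
    · rw [centIdx_zero]
    · rw [centIdx, dif_neg hk.ne']
      split_ifs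
      · exact (Nat.le_succ l).trans (ih _ (Nat.div_lt_self hk hp.out.one_lt) _)
      · exact Nat.le_succ l

theorem centIdx_pos (l : ℕ) {k : ℕ} (hk : k ≠ 0) : 0 < centIdx p l k := by
  rw [centIdx, dif_neg hk]
  split_ifs
  · exact (Nat.succ_pos l).trans_le (le_centIdx _ _)
  · exact Nat.succ_pos l

/-- Appending the base-`p` digit `p - 1` raises the level by one, starting from `k = p`. With `2 ≤
k`, each term of `μ` of positive index can be read off on a component that is a full copy of `E`. -/
theorem exists_centIdx_eq (i l : ℕ) : ∃ k, 2 ≤ k ∧ centIdx p l k = l + 1 + i := by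
  have h2 := hp.out.two_le
  induction i generalizing l with
  | zero =>
    exact ⟨p * 1 + 0, by omega, centIdx_of_lt l 1 (by omega) (by omega)⟩
  | succ i ih =>
    obtain ⟨k, hk, h⟩ := ih (l + 1)
    refine ⟨p * k + (p - 1), by nlinarith, ?_⟩
    rw [centIdx_of_eq l k (by omega), h]; ring

variable [CharP E p]

/-- Adding `p - 1 - r` and `p - 1 - t` produces a carry in base `p`, so `p` divides the binomial
coefficient. -/
theorem choose_eq_zero {r t : ℕ} (hr : r < p) (ht : t < p) (h : r + t + 1 < p) :
    ((p - 1 - r + (p - 1 - t)).choose (p - 1 - r) : E) = 0 := by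
  rw [CharP.cast_eq_zero_iff E p]
  exact hp.out.dvd_choose_add (by omega) (by omega) (by omega)

theorem choose_pascal {r t : ℕ} (hr : r + 1 < p) (ht : t + 1 < p) :
    ((p - 1 - r + (p - 1 - t)).choose (p - 1 - r) : E) =
      ((p - 1 - r + (p - 1 - (t + 1))).choose (p - 1 - r) : E) +
      ((p - 1 - (r + 1) + (p - 1 - t)).choose (p - 1 - (r + 1)) : E) := by
  obtain ⟨a, rfl⟩ : ∃ a, p = r + 2 + a := ⟨p - (r + 2), by omega⟩
  obtain ⟨b, hb⟩ : ∃ b, r + 2 + a - 1 - t = b + 1 := ⟨r + 2 + a - 1 - t - 1, by omega⟩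
  have h1 : r + 2 + a - 1 - (t + 1) = b := by omega
  have h2 : r + 2 + a - 1 - r = a + 1 := by omega
  have h3 : r + 2 + a - 1 - (r + 1) = a := by omega
  rw [hb, h1, h2, h3, ← add_assoc, Nat.choose_succ_succ, Nat.cast_add, add_comm]
  congr 3; ring_nf

/-- The basic commutation relation. -/
theorem coeffFun_comm (μ : ℕ → E) (a b : E) (l k m : ℕ) :
    coeffFun p μ l k m * (a + b * weight p μ l (m + k + 1)) -
      (a + b * weight p μ l m) * coeffFun p μ l k (m + 1) =
    (a + b * μ (centIdx p l k)) * coeffFun p μ l (k + 1) m := by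
  have h2 := hp.out.two_le
  induction k using Nat.strong_induction_on generalizing l m with
  | _ k ih =>
  obtain ⟨n, t, ht, rfl⟩ := exists_mul_add hp.out.pos m
  rcases Nat.eq_zero_or_pos k with rfl | hk
  · have e1 := coeffFun_mul_add μ l 0 n hp.out.one_lt ht (by omega)
    rw [mul_zero, zero_add, coeffFun_zero] at e1
    rw [centIdx_zero, zero_add, e1, coeffFun_zero, coeffFun_zero, add_zero]
    rcases (show t + 1 = p ∨ t + 1 + 1 = p ∨ t + 1 + 1 < p by omega) with h | h | h
    · have e3 : p * n + t + 1 = p * (n + 1) + 0 := by rw [mul_add]; omega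
      have e4 : p - 1 - t = 0 := by omega
      rw [weight_of_eq μ l n h, e3, weight_of_lt (t := 0) μ l _ h2, e4]
      simp
      ring
    · have e2 : p - 1 - 1 + (p - 1 - t) = p - 1 - 1 + 1 := by omega
      -- At `t = p - 2` the binomial coefficient is `p - 1`, which supplies the sign of the backward
      -- jump of the weight.
      have e3 : (((p - 1 - 1 + 1 : ℕ)) : E) = -1 := by
        rw [Nat.sub_add_cancel (by omega), Nat.cast_sub hp.out.one_lt.le, CharP.cast_eq_zero]
        simp
      rw [add_assoc (p * n), weight_of_eq μ l n h, weight_of_lt μ l n (by omega), e2,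
        Nat.choose_succ_self_right, e3]
      ring
    · rw [add_assoc (p * n), weight_of_lt μ l n h, weight_of_lt μ l n (by omega),
        choose_eq_zero hp.out.one_lt ht (by omega)]
      ring
  obtain ⟨j, r, hr, rfl⟩ := exists_mul_add hp.out.pos k
  rcases (show r + 1 < p ∨ r + 1 = p by omega) with hr' | hr'
  · rw [centIdx_of_lt l j hr' hk.ne', add_assoc (p * j),
      coeffFun_mul_add μ l j n hr' ht (by omega), coeffFun_mul_add μ l j n hr ht hk.ne']
    rcases (show t + 1 < p ∨ t + 1 = p by omega) with ht' | ht'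
    · rw [add_assoc (p * n) t 1, coeffFun_mul_add μ l j n hr ht' hk.ne', weight_of_lt μ l n ht']
      -- Without a carry, the factor multiplying the weight at `m + k + 1` vanishes. With a carry,
      -- the last digit of that position is below `p - 1`, so its weight is `μ (l + 1)` and Pascal's
      -- rule finishes.
      rcases (show r + t + 1 < p ∨ p ≤ r + t + 1 by omega) with h | h
      · have e1 := choose_eq_zero (E := E) hr ht h
        have e2 := choose_pascal (E := E) hr' ht'
        rw [e1] at e2 ⊢
        linear_combination (a + b * μ (l + 1)) * coeffFun p μ (l + 1) j n * e2
      · have : p * n + t + (p * j + r) + 1 = p * (n + j + 1) + (r + t + 1 - p) := by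
          rw [mul_add, mul_add]; omega
        rw [this, weight_of_lt μ l _ (by omega), choose_pascal hr' ht']
        ring
    · have e3 : p * n + t + 1 = p * (n + 1) + 0 := by rw [mul_add]; omega
      have e4 : p * n + t + (p * j + r) + 1 = p * (n + j + 1) + r := by
          rw [mul_add, mul_add]; omega
      have e5 : p - 1 - t = 0 := by omega
      rw [e3, coeffFun_mul_add μ l j (n + 1) hr (by omega) hk.ne',
        choose_eq_zero (t := 0) hr hp.out.pos (by omega), e4, weight_of_lt μ l _ hr', e5]
      simp
      ring
  · have e1 : p - 1 - r = 0 := by omega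
    have e2 : p * j + r + 1 = p * (j + 1) + 0 := by rw [mul_add]; omega
    rw [centIdx_of_eq l j hr', e2, coeffFun_mul_add μ l j n hr ht hk.ne',
      coeffFun_mul_add μ l (j + 1) n hp.out.pos ht (by omega), e1]
    rcases (show t + 1 < p ∨ t + 1 = p by omega) with ht' | ht'
    · have e4 : p * n + t + (p * j + r) + 1 = p * (n + j + 1) + t := by
          rw [mul_add, mul_add]; omega
      rw [e4, add_assoc (p * n) t 1, coeffFun_mul_add μ l j n hr ht' hk.ne', e1,
        weight_of_lt μ l _ ht', weight_of_lt μ l _ ht', choose_eq_zero (r := 0) hp.out.pos ht (by omega)]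
      simp
      ring
    · have e3 : p * n + t + 1 = p * (n + 1) + 0 := by rw [mul_add]; omega
      have e4 : p * n + t + (p * j + r) + 1 = p * (n + j + 1) + t := by
          rw [mul_add, mul_add]; omega
      have e5 : p - 1 - t = 0 := by omega
      rw [e4, e3, coeffFun_mul_add μ l j (n + 1) hr hp.out.pos hk.ne', e1,
        weight_of_eq μ l _ ht', weight_of_eq μ l _ ht', e5]
      -- Both last digits are `p - 1`: every binomial factor is 1 and the identity is the same one
      -- at the next level.
      have := ih j (by nlinarith) (l + 1) n
      simpa using this

-- The last digit `p - 1` in the position makes the binomial factor 1, so the claim descends to `k =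
-- 0`, where it is the hypothesis on `μ`.
omit [CharP E p] in
theorem exists_coeffFun_ne_zero {μ : ℕ → E} (hμ : ∀ l, ∃ i, l < i ∧ μ i ≠ μ l) (l k : ℕ) :
    ∃ m, coeffFun p μ l k m ≠ 0 := by
  have h2 := hp.out.two_le
  induction k using Nat.strong_induction_on generalizing l with
  | _ k ih =>
  rcases Nat.eq_zero_or_pos k with rfl | hk
  · obtain ⟨i, hi, h⟩ := hμ l
    -- Chosen so that the valuation in `weight` selects the term `μ i`.
    refine ⟨p ^ (i - l - 1) - 1, ?_⟩
    have h1 : p ^ (i - l - 1) - 1 + 1 = p ^ (i - l - 1) := Nat.sub_add_cancel (Nat.one_le_pow _ _ hp.out.pos)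
    rw [coeffFun_zero, weight, h1, padicValNat.prime_pow, sub_ne_zero]
    convert h using 2
    omega
  obtain ⟨j, r, hr, rfl⟩ := exists_mul_add hp.out.pos k
  obtain ⟨n, hn⟩ := ih j (by nlinarith) (l + 1)
  refine ⟨p * n + (p - 1), ?_⟩
  rw [coeffFun_mul_add μ l j n hr (by omega) hk.ne']
  simpa using hn

end Combinatorics

/-! ### Thin gradings from independent subspaces with the covering property -/

section Abstract

variable {F : Type*} [Field F] {A : Type*} [LieRing A] [LieAlgebra F A]
  {N : ℕ → Submodule F A}

/-- The Lie algebra generated by `N 1`. -/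
abbrev genAlg (N : ℕ → Submodule F A) : LieSubalgebra F A :=
  LieSubalgebra.lieSpan F A (N 1 : Set A)

theorem le_genAlg (h0 : N 0 = ⊥) (hne : ∀ i, 1 ≤ i → N i ≠ ⊥)
    (hcov : ∀ i, 1 ≤ i → ∀ a ∈ N i, a ≠ 0 → (N 1).map (LieAlgebra.ad F A a) = N (i + 1)) (i : ℕ) :
    N i ≤ (genAlg N).toSubmodule := by
  rcases Nat.eq_zero_or_pos i with rfl | hi
  · rw [h0]; exact bot_le
  induction i, hi using Nat.le_induction with
  | base => exact LieSubalgebra.subset_lieSpan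
  | succ i hi ih =>
    obtain ⟨a, ha, ha0⟩ := Submodule.exists_mem_ne_zero_of_ne_bot (hne i hi)
    rw [← hcov i hi a ha ha0]
    rintro _ ⟨b, hb, rfl⟩
    exact (genAlg N).lie_mem (ih ha) (LieSubalgebra.subset_lieSpan hb)

theorem lie_mem_succ
    (hcov : ∀ i, 1 ≤ i → ∀ a ∈ N i, a ≠ 0 → (N 1).map (LieAlgebra.ad F A a) = N (i + 1))
    {i : ℕ} (hi : 1 ≤ i) {a b : A} (ha : a ∈ N i) (hb : b ∈ N 1) : ⁅a, b⁆ ∈ N (i + 1) := by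
  by_cases h : a = 0
  · simp [h]
  · rw [← hcov i hi a ha h]
    exact ⟨b, hb, rfl⟩

theorem lie_mem_add (h0 : N 0 = ⊥) (hne : ∀ i, 1 ≤ i → N i ≠ ⊥)
    (hcov : ∀ i, 1 ≤ i → ∀ a ∈ N i, a ≠ 0 → (N 1).map (LieAlgebra.ad F A a) = N (i + 1))
    (i j : ℕ) {a b : A} (ha : a ∈ N i) (hb : b ∈ N j) : ⁅a, b⁆ ∈ N (i + j) := by
  rcases Nat.eq_zero_or_pos i with rfl | hi
  · rw [h0, Submodule.mem_bot] at ha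
    simp [ha]
  rcases Nat.eq_zero_or_pos j with rfl | hj
  · rw [h0, Submodule.mem_bot] at hb
    simp [hb]
  induction j, hj using Nat.le_induction generalizing i a b with
  | base => exact lie_mem_succ hcov hi ha hb
  | succ j hj ih =>
    -- By covering, `b` is a bracket `⁅c, d⁆` with `d` of degree one; the Jacobi identity then
    -- lowers `j`.
    obtain ⟨c, hc, hc0⟩ := Submodule.exists_mem_ne_zero_of_ne_bot (hne j hj)
    rw [← hcov j hj c hc hc0] at hb
    obtain ⟨d, hd, rfl⟩ := hb
    rw [LieAlgebra.ad_apply, leibniz_lie, ← lie_skew c, ← sub_eq_add_neg]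
    refine sub_mem ?_ ?_
    · have := lie_mem_succ hcov (by omega) (ih i ha hc hi) hd
      rwa [add_assoc] at this
    · have := ih (i + 1) (lie_mem_succ hcov hi ha hd) hc (by omega)
      rwa [show i + 1 + j = i + (j + 1) by ring] at this

theorem genAlg_toSubmodule (h0 : N 0 = ⊥) (hne : ∀ i, 1 ≤ i → N i ≠ ⊥)
    (hcov : ∀ i, 1 ≤ i → ∀ a ∈ N i, a ≠ 0 → (N 1).map (LieAlgebra.ad F A a) = N (i + 1)) :
    (genAlg N).toSubmodule = ⨆ i, N i := by
  refine le_antisymm ?_ (iSup_le (le_genAlg h0 hne hcov))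
  let K : LieSubalgebra F A :=
    { (⨆ i, N i : Submodule F A) with
      lie_mem' := by
        intro a b ha hb
        change ⁅a, b⁆ ∈ ⨆ i, N i
        refine Submodule.iSup_induction N (motive := fun a => ⁅a, b⁆ ∈ ⨆ i, N i) ha
          (fun i x hx => ?_) (by simp) (fun x y hx hy => by rw [add_lie]; exact add_mem hx hy)
        refine Submodule.iSup_induction N (motive := fun b => ⁅x, b⁆ ∈ ⨆ i, N i) hb
          (fun j y hy => ?_) (by simp) (fun y z hy hz => by rw [lie_add]; exact add_mem hy hz)
        exact Submodule.mem_iSup_of_mem (i + j) (lie_mem_add h0 hne hcov i j hx hy) }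
  have : genAlg N ≤ K := LieSubalgebra.lieSpan_le.2 fun x hx =>
    Submodule.mem_iSup_of_mem (p := N) 1 hx
  exact this

/-- The grading on `genAlg N` with components `N i`. -/
def grading (N : ℕ → Submodule F A) (i : ℕ) : Submodule F (genAlg N) :=
  (N i).comap (genAlg N).toSubmodule.subtype

theorem mem_grading {i : ℕ} {x : genAlg N} : x ∈ grading N i ↔ (x : A) ∈ N i := Iff.rfl

theorem finrank_grading (h0 : N 0 = ⊥) (hne : ∀ i, 1 ≤ i → N i ≠ ⊥)
    (hcov : ∀ i, 1 ≤ i → ∀ a ∈ N i, a ≠ 0 → (N 1).map (LieAlgebra.ad F A a) = N (i + 1)) (i : ℕ) :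
    Module.finrank F (grading N i) = Module.finrank F (N i) :=
  (Submodule.comapSubtypeEquivOfLe (le_genAlg h0 hne hcov i)).finrank_eq

theorem isThinGrading_grading (hind : iSupIndep N) (h0 : N 0 = ⊥) (hne : ∀ i, 1 ≤ i → N i ≠ ⊥)
    (h1 : Module.finrank F (N 1) = 2)
    (hcov : ∀ i, 1 ≤ i → ∀ a ∈ N i, a ≠ 0 → (N 1).map (LieAlgebra.ad F A a) = N (i + 1)) :
    IsThinGrading (grading N) where
  isInternal := by
    apply DirectSum.isInternal_submodule_of_iSupIndep_of_iSup_eq_top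
    · rw [iSupIndep_def]
      intro i
      rw [Submodule.disjoint_def]
      intro x hx hx'
      have h := Submodule.mem_map_of_mem (f := (genAlg N).toSubmodule.subtype) hx'
      simp only [Submodule.map_iSup] at h
      have h' : (x : A) ∈ ⨆ j, ⨆ (_ : j ≠ i), N j :=
        iSup₂_mono (fun j _ => Submodule.map_comap_le _ _) h
      exact Subtype.ext (Submodule.disjoint_def.1 (iSupIndep_def.1 hind i) _ hx h')
    · rw [eq_top_iff]
      intro x _
      have hx : (x : A) ∈ ⨆ i, N i := by
        rw [← genAlg_toSubmodule h0 hne hcov]; exact x.2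
      have : (⨆ i, N i) ≤ (⨆ i, grading N i).map (genAlg N).toSubmodule.subtype := by
        rw [Submodule.map_iSup]
        refine iSup_mono fun i a ha => ?_
        exact ⟨⟨a, le_genAlg h0 hne hcov i ha⟩, ha, rfl⟩
      obtain ⟨y, hy, hyx⟩ := this hx
      rwa [← Subtype.ext hyx]
  zero_eq := by
    rw [eq_bot_iff]
    intro x hx
    rw [mem_grading, h0, Submodule.mem_bot] at hx
    exact Subtype.ext hx
  lie_mem i j a ha b hb := lie_mem_add h0 hne hcov i j ha hb
  generated := by
    rw [eq_top_iff]
    intro x _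
    have hx := x.2
    let K := (LieSubalgebra.lieSpan F (genAlg N) (grading N 1 : Set (genAlg N))).map (genAlg N).incl
    have : genAlg N ≤ K := LieSubalgebra.lieSpan_le.2 fun a ha =>
      ⟨⟨a, LieSubalgebra.subset_lieSpan ha⟩, LieSubalgebra.subset_lieSpan ha, rfl⟩
    obtain ⟨y, hy, hyx⟩ := this hx
    have e : y = x := Subtype.ext hyx
    rwa [e] at hy
  finrank_one := (finrank_grading h0 hne hcov 1).trans h1
  covering i hi a ha ha0 := by
    have h := hcov i hi a ha (fun h => ha0 (Subtype.ext h))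
    ext x
    constructor
    · rintro ⟨b, hb, rfl⟩
      exact lie_mem_add h0 hne hcov i 1 ha hb
    · intro hx
      rw [mem_grading, ← h] at hx
      obtain ⟨b, hb, hbx⟩ := hx
      exact ⟨⟨b, LieSubalgebra.subset_lieSpan hb⟩, hb, Subtype.ext hbx⟩

end Abstract

/-! ### Weighted shifts and the superdiagonal filtration -/

section Shift

/-- Upper triangular matrices with rows and columns indexed by `ℕ`. -/
def UTri (E : Type*) [Field E] : Type _ := IncidenceAlgebra E ℕ

namespace UTri

variable {F E : Type*} [Field F] [Field E] [Algebra F E]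

noncomputable instance : Ring (UTri E) := inferInstanceAs (Ring (IncidenceAlgebra E ℕ))

noncomputable instance : Algebra F (UTri E) := inferInstanceAs (Algebra F (IncidenceAlgebra E ℕ))

noncomputable instance : LieRing (UTri E) := LieRing.ofAssociativeRing

noncomputable instance : LieAlgebra F (UTri E) := LieAlgebra.ofAssociativeAlgebra

/-- The entry at `(m, x)`. -/
def coeff (u : UTri E) (m x : ℕ) : E := IncidenceAlgebra.toFun u m x

instance : CoeFun (UTri E) fun _ => ℕ → ℕ → E := ⟨coeff⟩

theorem ext {u v : UTri E} (h : ∀ m x, u m x = v m x) : u = v :=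
  IncidenceAlgebra.ext fun m x _ => h m x

theorem add_apply (u v : UTri E) (m x : ℕ) : (u + v) m x = u m x + v m x := rfl

theorem sub_apply (u v : UTri E) (m x : ℕ) : (u - v) m x = u m x - v m x := rfl

theorem smul_apply (c : F) (u : UTri E) (m x : ℕ) : (c • u) m x = c • u m x := rfl

theorem mul_apply (u v : UTri E) (m x : ℕ) :
    (u * v) m x = ∑ y ∈ Finset.Icc m x, u m y * v y x := rfl

end UTri

variable (F : Type*) {E : Type*} [Field F] [Field E] [Algebra F E]

/-- The weighted shift by `k` with weights `g`, as an element of the incidence algebra of `ℕ`. -/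
def shift (k : ℕ) : (ℕ → E) →ₗ[F] UTri E where
  toFun g := ⟨fun m x => if x = m + k then g m else 0, fun m x h => if_neg (by omega)⟩
  map_add' g h := by
    refine UTri.ext fun m x => ?_
    change (if x = m + k then g m + h m else 0) =
      (if x = m + k then g m else 0) + if x = m + k then h m else 0
    split_ifs <;> simp
  map_smul' c g := by
    refine UTri.ext fun m x => ?_
    change (if x = m + k then c • g m else 0) = c • if x = m + k then g m else 0
    split_ifs <;> simp

theorem shift_apply (k : ℕ) (g : ℕ → E) (m x : ℕ) :
    shift F k g m x = if x = m + k then g m else 0 := rfl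

theorem shift_apply_self (k : ℕ) (g : ℕ → E) (m : ℕ) : shift F k g m (m + k) = g m := if_pos rfl

theorem shift_injective (k : ℕ) : Function.Injective (shift F k : (ℕ → E) →ₗ[F] _) := by
  intro g h e
  ext m
  rw [← shift_apply_self F k g, e, shift_apply_self]

/-- Elements whose entries below the `k`-th superdiagonal vanish. -/
def filt (E : Type*) [Field E] [Algebra F E] (k : ℕ) : Submodule F (UTri E) where
  carrier := {u | ∀ m x, x < m + k → u m x = 0}
  add_mem' hu hv m x h := by rw [UTri.add_apply, hu m x h, hv m x h, add_zero]
  zero_mem' _ _ _ := rfl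
  smul_mem' c u hu m x h := by rw [UTri.smul_apply, hu m x h, smul_zero]

/-- The entry at `(m, x)`. -/
def entry (E : Type*) [Field E] [Algebra F E] (m x : ℕ) : UTri E →ₗ[F] E where
  toFun u := u m x
  map_add' _ _ := rfl
  map_smul' _ _ := rfl

variable {F}

theorem shift_mem_filt (k : ℕ) (g : ℕ → E) : shift F k g ∈ filt F E k :=
  fun _ _ h => if_neg h.ne

theorem filt_anti {k l : ℕ} (h : k ≤ l) : filt F E l ≤ filt F E k :=
  fun _ hu m x hx => hu m x (by omega)

theorem mul_apply_of_mem_filt {k l : ℕ} {a b : UTri E} (ha : a ∈ filt F E k)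
    (hb : b ∈ filt F E l) (m : ℕ) :
    (a * b) m (m + k + l) = a m (m + k) * b (m + k) (m + k + l) := by
  rw [UTri.mul_apply]
  apply Finset.sum_eq_single_of_mem _ (Finset.mem_Icc.2 ⟨by omega, by omega⟩)
  intro x _ hx
  rcases lt_or_gt_of_ne hx with h | h
  · rw [ha m x h, zero_mul]
  · rw [hb x _ (by omega), mul_zero]

theorem mul_mem_filt {k l : ℕ} {a b : UTri E} (ha : a ∈ filt F E k)
    (hb : b ∈ filt F E l) : a * b ∈ filt F E (k + l) := by
  intro m x hx
  rw [UTri.mul_apply]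
  refine Finset.sum_eq_zero fun y _ => ?_
  rcases lt_or_ge y (m + k) with h | h
  · rw [ha m y h, zero_mul]
  · rw [hb y x (by omega), mul_zero]

theorem lie_mem_filt {k l : ℕ} {a b : UTri E} (ha : a ∈ filt F E k)
    (hb : b ∈ filt F E l) : ⁅a, b⁆ ∈ filt F E (k + l) := by
  rw [Ring.lie_def]
  refine sub_mem (mul_mem_filt ha hb) ?_
  rw [add_comm]
  exact mul_mem_filt hb ha

/-- The leading diagonal of a bracket depends only on the leading diagonals of its factors; this
makes symbols of non-homogeneous elements computable. -/
theorem lie_apply_of_mem_filt {k l : ℕ} {a b : UTri E} (ha : a ∈ filt F E k)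
    (hb : b ∈ filt F E l) (m : ℕ) :
    ⁅a, b⁆ m (m + (k + l)) =
      a m (m + k) * b (m + k) (m + k + l) - b m (m + l) * a (m + l) (m + l + k) := by
  rw [Ring.lie_def, UTri.sub_apply, ← mul_apply_of_mem_filt ha hb,
    ← mul_apply_of_mem_filt hb ha, ← add_assoc, add_right_comm m l k]

theorem lie_shift (k l : ℕ) (g h : ℕ → E) :
    ⁅shift F k g, shift F l h⁆ = shift F (k + l) fun m => g m * h (m + k) - h m * g (m + l) := by
  refine UTri.ext fun m x => ?_
  by_cases hx : x = m + (k + l)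
  · subst hx
    rw [lie_apply_of_mem_filt (shift_mem_filt k g) (shift_mem_filt l h)]
    simp only [shift_apply_self]
  · rw [shift_apply, if_neg hx, Ring.lie_def, UTri.sub_apply,
      UTri.mul_apply, UTri.mul_apply, Finset.sum_eq_zero,
      Finset.sum_eq_zero, sub_zero]
    all_goals
      intro y _
      simp only [shift_apply]
      split_ifs <;> first | omega | simp

theorem iSupIndep_range_shift :
    iSupIndep fun k => LinearMap.range (shift F k : (ℕ → E) →ₗ[F] _) := by
  rw [iSupIndep_def]
  intro k
  rw [Submodule.disjoint_def]
  rintro _ ⟨g, rfl⟩ h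
  have key : (⨆ j, ⨆ (_ : j ≠ k), LinearMap.range (shift F j : (ℕ → E) →ₗ[F] _)) ≤
      ⨅ m, LinearMap.ker (entry F E m (m + k)) := by
    refine iSup₂_le fun j hj => le_iInf fun m => ?_
    rintro _ ⟨g, rfl⟩
    exact if_neg (by omega)
  have hg : g = 0 := by
    ext m
    have := (Submodule.mem_iInf _).1 (key h) m
    exact (shift_apply_self F k g m).symm.trans this
  rw [hg, map_zero]

end Shift

/-! ### The thin algebra of a sequence `μ` -/

section Construction

variable (F : Type*) (p : ℕ) [hp : Fact p.Prime] {E : Type*} [Field F] [Field E] [Algebra F E]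
  (μ : ℕ → E)

/-- The weights of the element `a x + b y` of degree one. -/
def linFun : F × F →ₗ[F] (ℕ → E) where
  toFun c m := algebraMap F E c.1 + algebraMap F E c.2 * weight p μ 0 m
  map_add' c d := by
    ext m; simp only [Prod.fst_add, Prod.snd_add, map_add, Pi.add_apply]; ring
  map_smul' c d := by
    ext m
    simp only [Prod.smul_fst, Prod.smul_snd, smul_eq_mul, map_mul, RingHom.id_apply, Pi.smul_apply]
    rw [Algebra.smul_def c (_ : E)]
    ring

/-- The value `a + b z` for a pair `(a, b)`. -/
def linVal (z : E) : F × F →ₗ[F] E where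
  toFun c := algebraMap F E c.1 + algebraMap F E c.2 * z
  map_add' c d := by simp only [Prod.fst_add, Prod.snd_add, map_add]; ring
  map_smul' c d := by
    simp only [Prod.smul_fst, Prod.smul_snd, smul_eq_mul, map_mul, RingHom.id_apply]
    rw [Algebra.smul_def c (_ : E)]
    ring

/-- The functions `e * coeffFun k`, for `e : E`. -/
def scaleFun (k : ℕ) : E →ₗ[F] (ℕ → E) where
  toFun e m := e * coeffFun p μ 0 k m
  map_add' c d := by ext m; exact add_mul _ _ _
  map_smul' c d := by ext m; exact smul_mul_assoc _ _ _

/-- The homogeneous components of the algebra attached to the sequence `μ`. -/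
noncomputable def comp : ℕ → Submodule F (UTri E)
  | 0 => ⊥
  | 1 => LinearMap.range (shift F 1 ∘ₗ linFun F p μ)
  | 2 => LinearMap.range (shift F 2 ∘ₗ scaleFun F p μ 1 ∘ₗ Algebra.linearMap F E)
  | k + 3 => LinearMap.range (shift F (k + 3) ∘ₗ scaleFun F p μ (k + 2))

variable {F p μ}

theorem mem_comp_one {a : UTri E} :
    a ∈ comp F p μ 1 ↔ ∃ c, shift F 1 (linFun F p μ c) = a := by
  simp [comp]

theorem mem_comp_two {a : UTri E} :
    a ∈ comp F p μ 2 ↔ ∃ c : F, shift F 2 (scaleFun F p μ 1 (algebraMap F E c)) = a := by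
  simp [comp]

theorem mem_comp_add_three {k : ℕ} {a : UTri E} :
    a ∈ comp F p μ (k + 3) ↔ ∃ e : E, shift F (k + 3) (scaleFun F p μ (k + 2) e) = a := by
  simp [comp]

variable [CharP E p]

theorem lie_scaleFun_linFun (k : ℕ) (e : E) (c : F × F) :
    ⁅shift F (k + 1) (scaleFun F p μ k e), shift F 1 (linFun F p μ c)⁆ =
      shift F (k + 2) (scaleFun F p μ (k + 1) (linVal F (μ (centIdx p 0 k)) c * e)) := by
  rw [lie_shift]
  congr 1
  ext m
  simp only [scaleFun, linFun, linVal, LinearMap.coe_mk, AddHom.coe_mk]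
  linear_combination e * coeffFun_comm (p := p) μ (algebraMap F E c.1) (algebraMap F E c.2) 0 k m

theorem lie_linFun_linFun (h0 : μ 0 = 0) (c d : F × F) :
    ⁅shift F 1 (linFun F p μ c), shift F 1 (linFun F p μ d)⁆ =
      shift F 2 (scaleFun F p μ 1 (algebraMap F E (c.2 * d.1 - c.1 * d.2))) := by
  rw [lie_shift]
  congr 1
  ext m
  have := coeffFun_comm (p := p) μ 1 0 0 0 m
  simp only [coeffFun_zero, h0] at this
  simp only [scaleFun, linFun, LinearMap.coe_mk, AddHom.coe_mk]
  rw [map_sub (algebraMap F E), map_mul, map_mul]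
  linear_combination (algebraMap F E c.2 * algebraMap F E d.1 -
    algebraMap F E c.1 * algebraMap F E d.2) * this

omit [CharP E p] in
theorem linVal_injective {z : E} (hz : z ∉ Set.range (algebraMap F E)) :
    Function.Injective (linVal F z) := by
  rw [injective_iff_map_eq_zero]
  rintro ⟨a, b⟩ h
  simp only [linVal, LinearMap.coe_mk, AddHom.coe_mk] at h
  have hb : b = 0 := by
    by_contra hb
    refine hz ⟨-a / b, ?_⟩
    have : algebraMap F E b ≠ 0 := by simpa using hb
    rw [map_div₀, map_neg, div_eq_iff this]
    linear_combination -h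
  subst hb
  simpa using h

omit [CharP E p] in
theorem linVal_surjective (hE : Module.finrank F E = 2) {z : E}
    (hz : z ∉ Set.range (algebraMap F E)) : Function.Surjective (linVal F z) := by
  have : FiniteDimensional F E := Module.finite_of_finrank_eq_succ hE
  exact (LinearMap.injective_iff_surjective_of_finrank_eq_finrank (by simp [hE])).1
    (linVal_injective hz)

omit [CharP E p] in
theorem scaleFun_injective (hne : ∀ l, ∃ i, l < i ∧ μ i ≠ μ l) (k : ℕ) :
    Function.Injective (scaleFun F p μ k) := by
  rw [injective_iff_map_eq_zero]
  intro e h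
  obtain ⟨m, hm⟩ := exists_coeffFun_ne_zero (p := p) hne 0 k
  exact (mul_eq_zero.1 (congrFun h m)).resolve_right hm

/-- Bracketing with the two generators recovers both coordinates, up to sign, as multiples of the
nonzero `coeffFun 1`. -/
theorem linFun_injective (hne : ∀ l, ∃ i, l < i ∧ μ i ≠ μ l) (h0 : μ 0 = 0) :
    Function.Injective (linFun F p μ) := by
  rw [injective_iff_map_eq_zero]
  intro c h
  have h1 := lie_linFun_linFun (F := F) (p := p) h0 c (1, 0)
  have h2 := lie_linFun_linFun (F := F) (p := p) h0 c (0, 1)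
  rw [h, map_zero, zero_lie, eq_comm, ← map_zero (shift F 2)] at h1 h2
  replace h1 := shift_injective F 2 h1
  replace h2 := shift_injective F 2 h2
  rw [← map_zero (scaleFun F p μ 1)] at h1 h2
  replace h1 := scaleFun_injective hne 1 h1
  replace h2 := scaleFun_injective hne 1 h2
  simp at h1 h2
  exact Prod.ext h2 h1

variable (hE : Module.finrank F E = 2) (hμ : ∀ i, 0 < i → μ i ∉ Set.range (algebraMap F E))
  (hne : ∀ l, ∃ i, l < i ∧ μ i ≠ μ l) (h0 : μ 0 = 0)

omit [CharP E p] in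
theorem comp_le_range_shift (k : ℕ) :
    comp F p μ k ≤ LinearMap.range (shift F k : (ℕ → E) →ₗ[F] _) :=
  match k with
  | 0 => bot_le
  | 1 => LinearMap.range_comp_le_range _ _
  | 2 => LinearMap.range_comp_le_range _ _
  | _ + 3 => LinearMap.range_comp_le_range _ _

omit [CharP E p] in
theorem comp_le_filt (k : ℕ) : comp F p μ k ≤ filt F E k := by
  refine (comp_le_range_shift k).trans ?_
  rintro _ ⟨g, rfl⟩
  exact shift_mem_filt k g

omit [CharP E p] in
theorem iSupIndep_comp : iSupIndep (comp F p μ) := iSupIndep_range_shift.mono comp_le_range_shift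

include hne h0 in
theorem finrank_comp_one : Module.finrank F (comp F p μ 1) = 2 := by
  rw [comp, LinearMap.finrank_range_of_inj]
  · simp
  · exact (shift_injective F 1).comp (linFun_injective hne h0)

omit [CharP E p] in
include hne in
theorem finrank_comp_two : Module.finrank F (comp F p μ 2) = 1 := by
  rw [comp, LinearMap.finrank_range_of_inj]
  · simp
  · exact (shift_injective F 2).comp ((scaleFun_injective (F := F) hne 1).comp
      (algebraMap F E).injective)

omit [CharP E p] in
include hE hne in
theorem finrank_comp_of_le {k : ℕ} (hk : 3 ≤ k) : Module.finrank F (comp F p μ k) = 2 := by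
  obtain ⟨k, rfl⟩ := Nat.exists_eq_add_of_le' hk
  rw [comp, LinearMap.finrank_range_of_inj, hE]
  exact (shift_injective F _).comp (scaleFun_injective hne _)

include hE hne h0 in
theorem comp_ne_bot (k : ℕ) (hk : 1 ≤ k) : comp F p μ k ≠ ⊥ := by
  have : 0 < Module.finrank F (comp F p μ k) := by
    rcases (show k = 1 ∨ k = 2 ∨ 3 ≤ k by omega) with rfl | rfl | h
    · simp [finrank_comp_one hne h0]
    · simp [finrank_comp_two hne]
    · simp [finrank_comp_of_le hE hne h]
  intro h
  rw [h, finrank_bot] at this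
  exact this.false

theorem map_ad_scaleFun {k : ℕ} (e : E) :
    (comp F p μ 1).map (LieAlgebra.ad F _ (shift F (k + 1) (scaleFun F p μ k e))) =
      LinearMap.range (shift F (k + 2) ∘ₗ scaleFun F p μ (k + 1) ∘ₗ
        LinearMap.mulRight F e ∘ₗ linVal F (μ (centIdx p 0 k))) := by
  ext a
  simp only [Submodule.mem_map, mem_comp_one, LinearMap.mem_range, LieAlgebra.ad_apply]
  constructor
  · rintro ⟨_, ⟨c, rfl⟩, rfl⟩
    exact ⟨c, (lie_scaleFun_linFun k e c).symm⟩
  · rintro ⟨c, rfl⟩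
    exact ⟨_, ⟨c, rfl⟩, lie_scaleFun_linFun k e c⟩

include hE hμ in
theorem map_ad_scaleFun_eq {k : ℕ} (hk : 1 ≤ k) {e : E} (he : e ≠ 0) :
    (comp F p μ 1).map (LieAlgebra.ad F _ (shift F (k + 1) (scaleFun F p μ k e))) =
      comp F p μ (k + 2) := by
  obtain ⟨k, rfl⟩ := Nat.exists_eq_add_of_le' hk
  have h1 : Function.Surjective (linVal F (μ (centIdx p 0 (k + 1)))) :=
    linVal_surjective hE (hμ _ (centIdx_pos 0 (Nat.succ_ne_zero k)))
  have h2 : Function.Surjective (LinearMap.mulRight F e) :=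
    fun z => ⟨z / e, by simp [he]⟩
  rw [map_ad_scaleFun, comp, ← LinearMap.comp_assoc, LinearMap.range_comp_of_range_eq_top]
  rw [LinearMap.range_eq_top]
  exact h2.comp h1

include hE hμ h0 in
theorem map_ad_comp (i : ℕ) (hi : 1 ≤ i) (a : UTri E) (ha : a ∈ comp F p μ i)
    (ha0 : a ≠ 0) : (comp F p μ 1).map (LieAlgebra.ad F _ a) = comp F p μ (i + 1) := by
  match i with
  | 1 =>
    obtain ⟨c, rfl⟩ := mem_comp_one.1 ha
    have hc : c.1 ≠ 0 ∨ c.2 ≠ 0 := by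
      by_contra! h
      exact ha0 (by rw [show c = 0 from Prod.ext h.1 h.2, map_zero, map_zero])
    ext b
    simp only [Submodule.mem_map, mem_comp_one, LieAlgebra.ad_apply]
    rw [mem_comp_two]
    constructor
    · rintro ⟨_, ⟨d, rfl⟩, rfl⟩
      exact ⟨_, (lie_linFun_linFun h0 c d).symm⟩
    · rintro ⟨z, rfl⟩
      rcases hc with hc | hc
      · refine ⟨_, ⟨(0, - z / c.1), rfl⟩, ?_⟩
        rw [lie_linFun_linFun h0]
        congr 3
        field_simp
        ring
      · refine ⟨_, ⟨(z / c.2, 0), rfl⟩, ?_⟩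
        rw [lie_linFun_linFun h0]
        congr 3
        field_simp
        ring
  | 2 =>
    obtain ⟨c, rfl⟩ := mem_comp_two.1 ha
    refine map_ad_scaleFun_eq hE hμ le_rfl fun h => ha0 ?_
    rw [h, map_zero, map_zero]
  | k + 3 =>
    obtain ⟨e, rfl⟩ := mem_comp_add_three.1 ha
    refine map_ad_scaleFun_eq hE hμ (by omega) fun h => ha0 ?_
    rw [h, map_zero, map_zero]

include hE hμ hne h0 in
theorem isThinGrading_comp : IsThinGrading (grading (comp F p μ)) :=
  isThinGrading_grading iSupIndep_comp rfl (comp_ne_bot hE hne h0) (finrank_comp_one hne h0)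
    (map_ad_comp hE hμ h0)

include hE hμ hne h0 in
theorem finrank_grading_comp {i : ℕ} (hi : 3 ≤ i) :
    Module.finrank F (grading (comp F p μ) i) = 2 := by
  rw [finrank_grading rfl (comp_ne_bot hE hne h0) (map_ad_comp hE hμ h0),
    finrank_comp_of_le hE hne hi]

include hE hμ hne h0 in
theorem comp_le_genAlg (k : ℕ) : comp F p μ k ≤ (genAlg (comp F p μ)).toSubmodule :=
  le_genAlg rfl (comp_ne_bot hE hne h0) (map_ad_comp hE hμ h0) k

include hE hμ hne h0 in
theorem genAlg_comp_toSubmodule : (genAlg (comp F p μ)).toSubmodule = ⨆ k, comp F p μ k :=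
  genAlg_toSubmodule rfl (comp_ne_bot hE hne h0) (map_ad_comp hE hμ h0)

theorem lie_lie_mem_derivedSeries {L : Type*} [LieRing L] [LieAlgebra F L] (a b c d : L) :
    ⁅⁅a, b⁆, ⁅c, d⁆⁆ ∈ LieAlgebra.derivedSeries F L 2 := by
  have h : ∀ a b : L, ⁅a, b⁆ ∈ LieAlgebra.derivedSeries F L 1 := fun a b =>
    LieSubmodule.lie_mem_lie (LieSubmodule.mem_top a) (LieSubmodule.mem_top b)
  exact LieSubmodule.lie_mem_lie (h a b) (h c d)

-- The element `⁅⁅u, x⁆, ⁅x, y⁆⁆` has coefficient equal to the difference of the two consecutive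
-- values of `μ` met after `⁅u, x⁆`.
include hE hμ hne h0 in
theorem derivedSeries_two_ne_bot (h12 : μ 1 ≠ μ 2) :
    LieAlgebra.derivedSeries F (genAlg (comp F p μ)) 2 ≠ ⊥ := by
  have h2 := hp.out.two_le
  have hle := comp_le_genAlg (F := F) (p := p) hE hμ hne h0
  -- Here `k + 4 = p ^ 2`, so the indices at `k + 2` and `k + 3` are 1 and 2.
  obtain ⟨k, hk⟩ : ∃ k, p * (p - 1) + (p - 2) = k + 2 := by
    refine Nat.exists_eq_add_of_le' ?_
    rcases h2.eq_or_lt with h | h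
    · subst h; norm_num
    · have : 3 * (3 - 1) ≤ p * (p - 1) := Nat.mul_le_mul h (by omega)
      omega
  have c1 : centIdx p 0 (k + 2) = 1 := by
    rw [← hk]
    exact centIdx_of_lt 0 _ (by omega) (by omega)
  have c2 : centIdx p 0 (k + 3) = 2 := by
    have : k + 3 = p * (p - 1) + (p - 1) := by omega
    rw [this, centIdx_of_eq 0 _ (by omega)]
    have := centIdx_of_eq (p := p) 1 0 (r := p - 1) (by omega)
    rwa [mul_zero, zero_add, centIdx_zero] at this
  have hx := hle 1 (mem_comp_one.2 ⟨((1 : F), (0 : F)), rfl⟩)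
  have hy := hle 1 (mem_comp_one.2 ⟨((0 : F), (1 : F)), rfl⟩)
  have hu : shift F (k + 2) (scaleFun F p μ (k + 1) 1) ∈ genAlg (comp F p μ) := by
    rcases k with _ | k
    · exact hle 2 (mem_comp_two.2 ⟨1, by rw [map_one]⟩)
    · exact hle _ (mem_comp_add_three.2 ⟨1, rfl⟩)
  have l1 : ∀ z : E, linVal F z ((1 : F), (0 : F)) = 1 := fun z => by simp [linVal]
  have l2 : ∀ z : E, linVal F z ((0 : F), (1 : F)) = z := fun z => by simp [linVal]
  have key : ∀ a x y : UTri E, ⁅a, ⁅x, y⁆⁆ = ⁅⁅a, x⁆, y⁆ - ⁅⁅a, y⁆, x⁆ := fun a x y => by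
    rw [leibniz_lie, ← lie_skew x, ← sub_eq_add_neg]
  intro h
  have := lie_lie_mem_derivedSeries (F := F) (L := genAlg (comp F p μ)) ⟨_, hu⟩ ⟨_, hx⟩ ⟨_, hx⟩
    ⟨_, hy⟩
  rw [h, LieSubmodule.mem_bot] at this
  replace this := congrArg (Subtype.val : genAlg (comp F p μ) → UTri E) this
  simp only [LieSubalgebra.coe_bracket] at this
  rw [key, lie_scaleFun_linFun, lie_scaleFun_linFun, lie_scaleFun_linFun, lie_scaleFun_linFun,
    lie_scaleFun_linFun] at this
  simp only [l1, l2, mul_one, one_mul] at this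
  have h3 : shift F (k + 5) (scaleFun F p μ (k + 4) (μ (centIdx p 0 (k + 3)))) -
      shift F (k + 5) (scaleFun F p μ (k + 4) (μ (centIdx p 0 (k + 2)))) = 0 := this
  rw [c1, c2, ← map_sub, ← map_sub] at h3
  have h4 := shift_injective F _ (h3.trans (map_zero _).symm)
  exact h12 (sub_eq_zero.1 (scaleFun_injective (F := F) hne _ (h4.trans (map_zero _).symm))).symm

end Construction

/-! ### Recovering the sequence from the isomorphism class -/

section Rigidity

variable {F : Type*} {p : ℕ} [hp : Fact p.Prime] {E : Type*} [Field F] [Field E] [Algebra F E]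
  [CharP E p] {μ ν : ℕ → E} (hE : Module.finrank F E = 2)
  (hμ : ∀ i, 0 < i → μ i ∉ Set.range (algebraMap F E))
  (hμn : ∀ l, ∃ i, l < i ∧ μ i ≠ μ l) (hμ0 : μ 0 = 0)
  (hν : ∀ i, 0 < i → ν i ∉ Set.range (algebraMap F E))
  (hνn : ∀ l, ∃ i, l < i ∧ ν i ≠ ν l) (hν0 : ν 0 = 0)

include hE hμ hμn hμ0 in
theorem mem_filt_one (a : genAlg (comp F p μ)) : (a : UTri E) ∈ filt F E 1 := by
  have h : (a : UTri E) ∈ (genAlg (comp F p μ)).toSubmodule := a.2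
  rw [genAlg_comp_toSubmodule hE hμ hμn hμ0] at h
  have hk : ⨆ k, comp F p μ k ≤ filt F E 1 := iSup_le fun k => ?_
  · exact hk h
  rcases k with _ | k
  · exact bot_le
  · exact (comp_le_filt _).trans (filt_anti (by omega))

include hE hμ hμn hμ0 in
theorem exists_sum_comp (a : genAlg (comp F p μ)) : ∃ f : ℕ →₀ UTri E,
    (∀ k, f k ∈ comp F p μ k) ∧ (∀ k m, f k m (m + k) = (a : UTri E) m (m + k)) ∧
      f.sum (fun _ u => u) = a := by
  have h : (a : UTri E) ∈ (genAlg (comp F p μ)).toSubmodule := a.2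
  rw [genAlg_comp_toSubmodule hE hμ hμn hμ0, Submodule.mem_iSup_iff_exists_finsupp] at h
  obtain ⟨f, hf, hsum⟩ := h
  refine ⟨f, hf, fun k m => ?_, hsum⟩
  have h1 : (a : UTri E) m (m + k) = f.sum fun _ u => entry F E m (m + k) u := by
    rw [← hsum]
    exact map_finsuppSum (entry F E m (m + k)) f _
  rw [h1, Finsupp.sum, Finset.sum_eq_single k]
  · rfl
  · intro j _ hj
    obtain ⟨g, hg⟩ := comp_le_range_shift j (hf j)
    rw [← hg]
    exact if_neg (by omega)
  · intro hk
    rw [Finsupp.notMem_support_iff.1 hk, map_zero]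

-- No gradedness of `φ` is needed: the component of degree `k` consists of iterated brackets of
-- degree-one elements, and the whole target lies in the first filtration step.
include hE hμ hμn hμ0 hν hνn hν0 in
theorem map_comp_mem_filt (φ : genAlg (comp F p μ) →ₗ⁅F⁆ genAlg (comp F p ν)) (k : ℕ)
    (a : genAlg (comp F p μ)) (ha : (a : UTri E) ∈ comp F p μ k) :
    (φ a : UTri E) ∈ filt F E k := by
  rcases k with _ | k
  · exact filt_anti (Nat.zero_le 1) (mem_filt_one hE hν hνn hν0 _)
  induction k generalizing a with
  | zero => exact mem_filt_one hE hν hνn hν0 _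
  | succ k ih =>
    obtain ⟨c, hc, hc0⟩ :=
      Submodule.exists_mem_ne_zero_of_ne_bot (comp_ne_bot (F := F) (p := p) hE hμn hμ0 (k + 1) (by omega))
    rw [← map_ad_comp hE hμ hμ0 (k + 1) (by omega) c hc hc0] at ha
    obtain ⟨b, hb, hba⟩ := ha
    have hle := comp_le_genAlg (F := F) (p := p) hE hμ hμn hμ0
    have : a = ⁅(⟨c, hle _ hc⟩ : genAlg (comp F p μ)), (⟨b, hle _ hb⟩ : genAlg (comp F p μ))⁆ :=
      Subtype.ext hba.symm
    rw [this, LieHom.map_lie]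
    exact lie_mem_filt (ih _ hc) (mem_filt_one hE hν hνn hν0 _)

include hE hμ hμn hμ0 hν hνn hν0 in
theorem map_mem_filt (φ : genAlg (comp F p μ) →ₗ⁅F⁆ genAlg (comp F p ν)) (k : ℕ)
    (a : genAlg (comp F p μ)) (ha : (a : UTri E) ∈ filt F E k) :
    (φ a : UTri E) ∈ filt F E k := by
  obtain ⟨f, hf, hfa, hsum⟩ := exists_sum_comp hE hμ hμn hμ0 a
  let K : Submodule F (genAlg (comp F p μ)) := (filt F E k).comap
    ((genAlg (comp F p ν)).toSubmodule.subtype ∘ₗ (φ : genAlg (comp F p μ) →ₗ[F] _))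
  have h : (a : UTri E) ∈ K.map (genAlg (comp F p μ)).toSubmodule.subtype := by
    rw [← hsum]
    refine Submodule.sum_mem _ fun i _ => ?_
    refine ⟨⟨f i, comp_le_genAlg hE hμ hμn hμ0 i (hf i)⟩, ?_, rfl⟩
    rcases lt_or_ge i k with h | h
    · have h0 : f i = 0 := by
        obtain ⟨g, hg⟩ := comp_le_range_shift i (hf i)
        have : g = 0 := by
          ext m
          rw [← shift_apply_self F i g m, hg, hfa]
          exact ha m _ (by omega)
        rw [← hg, this, map_zero]
      have h0' : (⟨f i, comp_le_genAlg hE hμ hμn hμ0 i (hf i)⟩ : genAlg (comp F p μ)) = 0 :=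
        Subtype.ext h0
      rw [h0']
      exact zero_mem K
    · exact filt_anti h (map_comp_mem_filt hE hμ hμn hμ0 hν hνn hν0 φ i _ (hf i))
  obtain ⟨b, hb, hba⟩ := h
  rw [← (Subtype.ext hba : b = a)]
  exact hb

/-- The leading coefficient of the image of `e * coeffFun k` is `e'`. -/
def IsSymbol (φ : genAlg (comp F p μ) →ₗ⁅F⁆ genAlg (comp F p ν)) (k : ℕ) (e e' : E) : Prop :=
  ∀ u : genAlg (comp F p μ), (u : UTri E) = shift F (k + 1) (scaleFun F p μ k e) →
    ∀ m, (φ u : UTri E) m (m + (k + 1)) = e' * coeffFun p ν 0 k m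

variable (φ : genAlg (comp F p μ) →ₗ⁅F⁆ genAlg (comp F p ν))

include hE hμ hμn hμ0 in
theorem exists_coe_eq {k : ℕ} (hk : 2 ≤ k) (e : E) :
    ∃ u : genAlg (comp F p μ), (u : UTri E) = shift F (k + 1) (scaleFun F p μ k e) := by
  obtain ⟨k, rfl⟩ := Nat.exists_eq_add_of_le' hk
  exact ⟨⟨_, comp_le_genAlg hE hμ hμn hμ0 _ (mem_comp_add_three.2 ⟨e, rfl⟩)⟩, rfl⟩

include hE hν hνn hν0 in
theorem exists_isSymbol {k : ℕ} (hk : 2 ≤ k) (e : E) : ∃ e', IsSymbol φ k e e' := by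
  by_cases h : ∃ u : genAlg (comp F p μ), (u : UTri E) = shift F (k + 1) (scaleFun F p μ k e)
  · obtain ⟨u, hu⟩ := h
    obtain ⟨f, hf, hfa, -⟩ := exists_sum_comp hE hν hνn hν0 (φ u)
    obtain ⟨k, rfl⟩ := Nat.exists_eq_add_of_le' hk
    obtain ⟨e', he'⟩ := mem_comp_add_three.1 (hf (k + 3))
    refine ⟨e', fun v hv m => ?_⟩
    rw [show v = u from Subtype.ext (hv.trans hu.symm)]
    rw [← hfa (k + 3), ← he', shift_apply_self]
    rfl
  -- If the source element is absent, the condition is vacuous and any value serves.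
  · exact ⟨0, fun u hu => (h ⟨u, hu⟩).elim⟩

include hE hμ hμn hμ0 hνn in
theorem IsSymbol.unique {k : ℕ} (hk : 2 ≤ k) {e a b : E} (ha : IsSymbol φ k e a)
    (hb : IsSymbol φ k e b) : a = b := by
  obtain ⟨u, hu⟩ := exists_coe_eq (F := F) (p := p) hE hμ hμn hμ0 hk e
  obtain ⟨m, hm⟩ := exists_coeffFun_ne_zero (p := p) hνn 0 k
  exact mul_right_cancel₀ hm ((ha u hu m).symm.trans (hb u hu m))

include hE hμ hμn hμ0 in
theorem IsSymbol.add_smul {k : ℕ} (hk : 2 ≤ k) {e d a b : E} (ha : IsSymbol φ k e a)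
    (hb : IsSymbol φ k d b) (c : F) : IsSymbol φ k (e + c • d) (a + c • b) := by
  obtain ⟨u, hu⟩ := exists_coe_eq (F := F) (p := p) hE hμ hμn hμ0 hk e
  obtain ⟨v, hv⟩ := exists_coe_eq (F := F) (p := p) hE hμ hμn hμ0 hk d
  intro w hw m
  have : w = u + c • v := Subtype.ext <| by
    rw [hw, map_add, map_add, map_smul, map_smul, ← hu, ← hv]; rfl
  rw [this, map_add, map_smul]
  change (φ u : UTri E) m (m + (k + 1)) + c • (φ v : UTri E) m (m + (k + 1)) = _
  rw [ha u hu, hb v hv, _root_.add_mul, smul_mul_assoc]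

include hE hμ hμn hμ0 hν hνn hν0 in
theorem IsSymbol.step {k : ℕ} (hk : 2 ≤ k) {e a : E} (ha : IsSymbol φ k e a) {c d : F × F}
    {x : genAlg (comp F p μ)} (hx : (x : UTri E) = shift F 1 (linFun F p μ c))
    (hd : ∀ m, (φ x : UTri E) m (m + 1) = linFun F p ν d m) :
    IsSymbol φ (k + 1) (linVal F (μ (centIdx p 0 k)) c * e)
      (linVal F (ν (centIdx p 0 k)) d * a) := by
  obtain ⟨u, hu⟩ := exists_coe_eq (F := F) (p := p) hE hμ hμn hμ0 hk e
  have hu' : (φ u : UTri E) ∈ filt F E (k + 1) :=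
    map_mem_filt hE hμ hμn hμ0 hν hνn hν0 φ (k + 1) u (hu ▸ shift_mem_filt _ _)
  intro w hw m
  have : w = ⁅u, x⁆ := Subtype.ext <| by
    rw [hw, LieSubalgebra.coe_bracket, hu, hx, lie_scaleFun_linFun]
  rw [this, LieHom.map_lie, LieSubalgebra.coe_bracket]
  rw [lie_apply_of_mem_filt hu' (mem_filt_one hE hν hνn hν0 (φ x)), ha u hu m, hd, hd,
    ha u hu (m + 1)]
  have := coeffFun_comm (p := p) ν (algebraMap F E d.1) (algebraMap F E d.2) 0 k m
  simp only [linFun, linVal, LinearMap.coe_mk, AddHom.coe_mk]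
  linear_combination a * this

-- A zero symbol would push the image one filtration step deeper; the inverse isomorphism would then
-- pull the source element there too, although its leading diagonal is nonzero.
include hE hμ hμn hμ0 hν hνn hν0 in
theorem IsSymbol.ne_zero (φ : genAlg (comp F p μ) ≃ₗ⁅F⁆ genAlg (comp F p ν)) {k : ℕ} (hk : 2 ≤ k)
    {a : E} (ha : IsSymbol (φ : genAlg (comp F p μ) →ₗ⁅F⁆ genAlg (comp F p ν)) k 1 a) : a ≠ 0 := by
  rintro rfl
  obtain ⟨u, hu⟩ := exists_coe_eq (F := F) (p := p) hE hμ hμn hμ0 hk 1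
  have hu' : (φ u : UTri E) ∈ filt F E (k + 1) :=
    map_mem_filt hE hμ hμn hμ0 hν hνn hν0 φ (k + 1) u (hu ▸ shift_mem_filt _ _)
  have hu2 : (φ u : UTri E) ∈ filt F E (k + 2) := by
    intro m x hx
    rcases (show x < m + (k + 1) ∨ x = m + (k + 1) by omega) with h | rfl
    · exact hu' m x h
    · exact (ha u hu m).trans (zero_mul _)
  have h := map_mem_filt hE hν hνn hν0 hμ hμn hμ0 φ.symm (k + 2) (φ u) hu2
  have h1 : (φ.symm : genAlg (comp F p ν) →ₗ⁅F⁆ genAlg (comp F p μ)) (φ u) = u :=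
    φ.symm_apply_apply u
  rw [h1, hu] at h
  obtain ⟨m, hm⟩ := exists_coeffFun_ne_zero (p := p) hμn 0 k
  have := h m (m + (k + 1)) (by omega)
  rw [shift_apply_self] at this
  exact hm ((one_mul _).symm.trans this)

include hE hν hνn hν0 in
theorem exists_linFun (x : genAlg (comp F p ν)) :
    ∃ d, ∀ m, (x : UTri E) m (m + 1) = linFun F p ν d m := by
  obtain ⟨f, hf, hfa, -⟩ := exists_sum_comp hE hν hνn hν0 x
  obtain ⟨d, hd⟩ := mem_comp_one.1 (hf 1)
  exact ⟨d, fun m => by rw [← hfa 1, ← hd, shift_apply_self]⟩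

-- Here `(a, b)` and `(c, d)` are the degree-one parts of the images of `x` and `y`. Symbols are
-- only `F`-linear in the source, so the image of `w` is a new constant `ρ`; writing `μ (i + 1)` as
-- `w` plus a scalar and computing the symbol of a bracket with `y` in two ways gives the relation.
include hE hμ hμn hμ0 hν hνn hν0 in
theorem exists_relation (φ : genAlg (comp F p μ) ≃ₗ⁅F⁆ genAlg (comp F p ν)) {w : E} {s : ℕ → F}
    (hs : ∀ i, μ (i + 1) = w + algebraMap F E (s i)) :
    ∃ (ρ : E) (a b c d : F), ∀ i,
      linVal F (ν (i + 1)) (a, b) ≠ 0 ∧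
      (ρ + algebraMap F E (s i)) * linVal F (ν (i + 1)) (a, b) = linVal F (ν (i + 1)) (c, d) := by
  have hle := comp_le_genAlg (F := F) (p := p) hE hμ hμn hμ0
  let x : genAlg (comp F p μ) := ⟨_, hle 1 (mem_comp_one.2 ⟨((1 : F), (0 : F)), rfl⟩)⟩
  let y : genAlg (comp F p μ) := ⟨_, hle 1 (mem_comp_one.2 ⟨((0 : F), (1 : F)), rfl⟩)⟩
  obtain ⟨⟨a, b⟩, hx⟩ := exists_linFun hE hν hνn hν0 (φ x)
  obtain ⟨⟨c, d⟩, hy⟩ := exists_linFun hE hν hνn hν0 (φ y)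
  let ψ : genAlg (comp F p μ) →ₗ⁅F⁆ genAlg (comp F p ν) := φ
  have l1 : ∀ z : E, linVal F z ((1 : F), (0 : F)) = 1 := fun z => by simp [linVal]
  have l2 : ∀ z : E, linVal F z ((0 : F), (1 : F)) = z := fun z => by simp [linVal]
  have hxs : ∀ {k : ℕ}, 2 ≤ k → ∀ {e e' : E}, IsSymbol ψ k e e' →
      IsSymbol ψ (k + 1) e (linVal F (ν (centIdx p 0 k)) (a, b) * e') := fun {k} hk {e e'} h => by
    have := IsSymbol.step hE hμ hμn hμ0 hν hνn hν0 ψ hk h (x := x) rfl hx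
    rwa [l1, one_mul] at this
  have hys : ∀ {k : ℕ}, 2 ≤ k → ∀ {e'}, IsSymbol ψ k 1 e' →
      IsSymbol ψ (k + 1) (μ (centIdx p 0 k)) (linVal F (ν (centIdx p 0 k)) (c, d) * e') :=
    fun {k} hk {e'} h => by
      have := IsSymbol.step hE hμ hμn hμ0 hν hνn hν0 ψ hk h (x := y) rfl hy
      rwa [l2, mul_one] at this
  obtain ⟨a₁, h₁⟩ := exists_isSymbol hE hν hνn hν0 ψ le_rfl 1
  obtain ⟨a₂, h₂⟩ := exists_isSymbol hE hν hνn hν0 ψ le_rfl w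
  have ha₁ := IsSymbol.ne_zero hE hμ hμn hμ0 hν hνn hν0 φ le_rfl h₁
  -- Bracketing with `x` fixes source coefficients and multiplies all target symbols by one factor,
  -- so the ratio of the symbols of `w` and `1` is independent of `k`.
  have key : ∀ k, 2 ≤ k → ∃ z, IsSymbol ψ k 1 z ∧ IsSymbol ψ k w (a₂ / a₁ * z) := by
    intro k hk
    induction k, hk using Nat.le_induction with
    | base => exact ⟨a₁, h₁, by rwa [div_mul_cancel₀ _ ha₁]⟩
    | succ k hk ih =>
      obtain ⟨z, hz, hz'⟩ := ih
      exact ⟨_, hxs hk hz, by rw [mul_left_comm]; exact hxs hk hz'⟩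
  refine ⟨a₂ / a₁, a, b, c, d, fun i => ?_⟩
  obtain ⟨k, hk, hki⟩ := exists_centIdx_eq (p := p) i 0
  rw [zero_add, add_comm] at hki
  obtain ⟨z, hz, hz'⟩ := key k hk
  have hz0 := IsSymbol.ne_zero hE hμ hμn hμ0 hν hνn hν0 φ hk hz
  have e1 := hxs hk hz
  have e2 := hxs hk hz'
  have e3 := hys hk hz
  have hne := IsSymbol.ne_zero hE hμ hμn hμ0 hν hνn hν0 φ (by omega) e1
  have e4 := IsSymbol.add_smul hE hμ hμn hμ0 ψ (by omega) e2 e1 (s i)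
  rw [hki] at hne e3 e4
  refine ⟨left_ne_zero_of_mul hne, ?_⟩
  rw [hs i, ← mul_one (algebraMap F E (s i)), ← Algebra.smul_def] at e3
  have := IsSymbol.unique hE hμ hμn hμ0 hνn ψ (by omega) e4 e3
  rw [Algebra.smul_def] at this
  apply mul_right_cancel₀ hz0
  linear_combination this

theorem eq_of_relation {w ρ : E} {a b c d t : F} {s s' : ℕ → F}
    (h : ∀ i, linVal F (w + algebraMap F E (s' i)) (a, b) ≠ 0 ∧
      (ρ + algebraMap F E (s i)) * linVal F (w + algebraMap F E (s' i)) (a, b) =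
        linVal F (w + algebraMap F E (s' i)) (c, d))
    (ht : t = 0 ∨ t = 1 → ∀ z : F, z = 0 ∨ z = 1)
    (h0 : s 0 = 0) (h1 : s 1 = 1) (h2 : s 2 = t) (h0' : s' 0 = 0) (h1' : s' 1 = 1) (h2' : s' 2 = t) :
    s = s' := by
  set f := algebraMap F E with hf
  have hl : ∀ z u v, linVal F z (u, v) = f u + f v * z := fun _ _ _ => rfl
  simp only [hl] at h
  have k0 := h 0
  have k1 := h 1
  have k2 := h 2
  rw [h0, h0', map_zero, add_zero, add_zero] at k0
  rw [h1, h1', map_one] at k1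
  rw [h2, h2'] at k2
  -- The values at `i = 0, 1` eliminate `ρ`, `c` and `d`.
  have key : ∀ i, (f a + f b * w) * (f (s' i) - f (s i)) = f b * f (s' i) * (f (s i) - 1) := by
    intro i
    linear_combination k0.2 * (1 - f (s' i)) + k1.2 * f (s' i) - (h i).2
  funext i
  apply f.injective
  by_cases hb : f b = 0
  · have := key i
    rw [hb, zero_mul, zero_mul, zero_mul, add_zero, mul_eq_zero] at this
    rw [hb, zero_mul, add_zero] at k0
    exact (sub_eq_zero.1 (this.resolve_left k0.1)).symm
  -- If `b ≠ 0`, the third normalized term gives `t * (t - 1) = 0`, so `F` has two elements. Then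
  -- unequal values at `i` contradict the nonvanishing at `i = 0` or `i = 1`.
  · have ht' : t = 0 ∨ t = 1 := by
      have := key 2
      rw [h2, h2', sub_self, mul_zero, eq_comm, mul_eq_zero, mul_eq_zero, sub_eq_zero,
        map_eq_one_iff _ f.injective] at this
      simpa [hb] using this
    have hi := key i
    rcases ht ht' (s i) with hsi | hsi <;> rcases ht ht' (s' i) with hsi' | hsi' <;>
      rw [hsi, hsi'] at hi ⊢
    · exfalso
      apply k1.1
      simp only [map_zero, map_one] at hi
      linear_combination hi
    · exfalso
      apply k0.1
      simp only [map_zero, map_one] at hi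
      linear_combination -hi

end Rigidity

/-! ### Counting by structure constants -/

section UpperBound

/-- Closing a countable generating set under brackets keeps it countable, and its span is then a
subalgebra. -/
theorem exists_countable_span_eq_top {F L : Type*} [Field F] [LieRing L] [LieAlgebra F L]
    {S : Set L} (hS : S.Countable) (hgen : LieSubalgebra.lieSpan F L S = ⊤) :
    ∃ C : Set L, C.Countable ∧ Submodule.span F C = ⊤ := by
  let C : ℕ → Set L := fun n => Nat.rec S (fun _ D => D ∪ Set.image2 (fun a b => ⁅a, b⁆) D D) n
  have hC : ∀ n, C (n + 1) = C n ∪ Set.image2 (fun a b => ⁅a, b⁆) (C n) (C n) := fun _ => rfl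
  have hmono : Monotone C := monotone_nat_of_le_succ fun n => Set.subset_union_left
  have hcount : ∀ n, (C n).Countable := fun n => by
    induction n with
    | zero => exact hS
    | succ n ih => exact ih.union (ih.image2 ih _)
  refine ⟨⋃ n, C n, Set.countable_iUnion hcount, ?_⟩
  have hlie : ∀ a ∈ ⋃ n, C n, ∀ b ∈ ⋃ n, C n, ⁅a, b⁆ ∈ ⋃ n, C n := by
    intro a ha b hb
    obtain ⟨i, hi⟩ := Set.mem_iUnion.1 ha
    obtain ⟨j, hj⟩ := Set.mem_iUnion.1 hb
    exact Set.mem_iUnion.2 ⟨max i j + 1, Or.inr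
      ⟨a, hmono (le_max_left i j) hi, b, hmono (le_max_right i j) hj, rfl⟩⟩
  let K : LieSubalgebra F L :=
    { Submodule.span F (⋃ n, C n) with
      lie_mem' := by
        intro a b ha hb
        change ⁅a, b⁆ ∈ Submodule.span F (⋃ n, C n)
        induction ha using Submodule.span_induction with
        | mem a ha =>
          induction hb using Submodule.span_induction with
          | mem b hb => exact Submodule.subset_span (hlie a ha b hb)
          | zero => rw [lie_zero]; exact zero_mem _
          | add x y _ _ hx hy => rw [lie_add]; exact add_mem hx hy
          | smul c x _ hx => rw [lie_smul]; exact Submodule.smul_mem _ c hx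
        | zero => rw [zero_lie]; exact zero_mem _
        | add x y _ _ hx hy => rw [add_lie]; exact add_mem hx hy
        | smul c x _ hx => rw [smul_lie]; exact Submodule.smul_mem _ c hx }
  have hK : LieSubalgebra.lieSpan F L S ≤ K := LieSubalgebra.lieSpan_le.2 fun x hx =>
    Submodule.subset_span (Set.mem_iUnion.2 ⟨0, hx⟩)
  rw [hgen] at hK
  rw [eq_top_iff]
  intro x _
  exact hK (LieSubalgebra.mem_top x)

variable {F : Type u} [Field F]

/-- `L` has a basis, indexed by the set where `χ` is `1`, with structure constants `c`. -/
def HasStructureConstants (L : LieAlgOver F) (c : (ℕ → F) × (ℕ → ℕ → ℕ → F)) : Prop :=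
  ∃ b : Module.Basis {i // c.1 i = 1} F L.carrier, ∀ i j k, b.repr ⁅b i, b j⁆ k = c.2 i j k

theorem exists_hasStructureConstants {L : LieAlgOver F} (hL : L.IsThin) :
    ∃ c, HasStructureConstants L c := by
  obtain ⟨𝒜, h⟩ := hL
  have hfin : FiniteDimensional F (𝒜 1) := Module.finite_of_finrank_eq_succ h.finrank_one
  obtain ⟨S, hS⟩ : (𝒜 1).FG := Module.Finite.iff_fg.1 hfin
  have hgen : LieSubalgebra.lieSpan F L.carrier (S : Set L.carrier) = ⊤ := by
    rw [eq_top_iff, ← h.generated, LieSubalgebra.lieSpan_le, ← hS]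
    exact Submodule.span_le (p := (LieSubalgebra.lieSpan F L.carrier S).toSubmodule).2
      LieSubalgebra.subset_lieSpan
  obtain ⟨C, hC, hspan⟩ := exists_countable_span_eq_top S.countable_toSet hgen
  obtain ⟨B, hBC, hBs, hBi⟩ := exists_linearIndependent F C
  have hB : B.Countable := hC.mono hBC
  have : Countable B := hB.to_subtype
  let b : Module.Basis B F L.carrier := Module.Basis.mk hBi (by
    rw [Subtype.range_coe, hBs, hspan])
  obtain ⟨g, hg⟩ := exists_injective_nat B
  classical
  -- The index set of the basis, possibly finite, is coded by an `F`-valued indicator so that all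
  -- the data are functions into `F`.
  let χ : ℕ → F := fun i => if i ∈ Set.range g then 1 else 0
  have hχ : ∀ i, i ∈ Set.range g ↔ χ i = 1 := fun i =>
    ⟨fun h => if_pos h, fun h => by_contra fun hi => zero_ne_one ((if_neg hi).symm.trans h)⟩
  let e : B ≃ {i // χ i = 1} := (Equiv.ofInjective g hg).trans (Equiv.subtypeEquivRight hχ)
  let b' := b.reindex e
  refine ⟨⟨χ, fun i j k => if hi : χ i = 1 then if hj : χ j = 1 then if hk : χ k = 1 then
    b'.repr ⁅b' ⟨i, hi⟩, b' ⟨j, hj⟩⁆ ⟨k, hk⟩ else 0 else 0 else 0⟩, b', fun i j k => ?_⟩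
  simp only [dif_pos i.2, dif_pos j.2, dif_pos k.2]

theorem HasStructureConstants.nonempty_equiv {L M : LieAlgOver F}
    {c : (ℕ → F) × (ℕ → ℕ → ℕ → F)} (hL : HasStructureConstants L c)
    (hM : HasStructureConstants M c) : Nonempty (L.carrier ≃ₗ⁅F⁆ M.carrier) := by
  obtain ⟨b, hb⟩ := hL
  obtain ⟨d, hd⟩ := hM
  let e : L.carrier ≃ₗ[F] M.carrier := b.equiv d (Equiv.refl _)
  have hei : ∀ i, e (b i) = d i := fun i => b.equiv_apply i d (Equiv.refl _)
  let B₁ : L.carrier →ₗ[F] L.carrier →ₗ[F] M.carrier :=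
    (LieModule.toEnd F L.carrier L.carrier : L.carrier →ₗ[F] _).compr₂ (e : L.carrier →ₗ[F] M.carrier)
  let B₂ : L.carrier →ₗ[F] L.carrier →ₗ[F] M.carrier :=
    (LieModule.toEnd F M.carrier M.carrier : M.carrier →ₗ[F] _).compl₁₂
      (e : L.carrier →ₗ[F] M.carrier) (e : L.carrier →ₗ[F] M.carrier)
  have hB : B₁ = B₂ := by
    refine b.ext fun i => b.ext fun j => ?_
    change e ⁅b i, b j⁆ = ⁅e (b i), e (b j)⁆
    rw [hei, hei]
    apply d.repr.injective
    ext k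
    rw [hd, ← hb]
    simp [e, Module.Basis.equiv]
  exact ⟨{ e with map_lie' := fun {x y} => LinearMap.congr_fun₂ hB x y }⟩

omit [Field F] in
theorem mk_structureConstants : #((ℕ → F) × (ℕ → ℕ → ℕ → F)) = #F ^ ℵ₀ := by
  have h : ∀ X : Type u, #(ℕ → X) = #X ^ ℵ₀ := fun X => by simp
  rw [Cardinal.mk_prod, h, h, h, h, ← Cardinal.power_mul, ← Cardinal.power_mul,
    Cardinal.aleph0_mul_aleph0, Cardinal.aleph0_mul_aleph0, Cardinal.lift_id, ← Cardinal.power_add,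
    Cardinal.aleph0_add_aleph0]

theorem numIsoClasses_isThin_le :
    LieAlgOver.numIsoClasses (F := F) LieAlgOver.IsThin ≤ Cardinal.lift.{u + 1, u} (#F ^ ℵ₀) := by
  choose L hL hLc using fun c : {c : Quotient (LieAlgOver.isoSetoid F) //
    ∃ L : LieAlgOver F, L.IsThin ∧ Quotient.mk (LieAlgOver.isoSetoid F) L = c} => c.2
  choose s hs using fun c => exists_hasStructureConstants (hL c)
  have hinj : Function.Injective s := fun c d hcd => by
    have h := hs c
    rw [hcd] at h
    apply Subtype.ext
    rw [← hLc c, ← hLc d]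
    exact Quotient.sound (s := LieAlgOver.isoSetoid F) (h.nonempty_equiv (hs d))
  have := Cardinal.mk_le_of_injective (f := fun c => ULift.up.{u + 1} (s c))
    fun c d h => hinj (ULift.up_injective h)
  rwa [Cardinal.mk_uLift, mk_structureConstants] at this

end UpperBound

/-! ### A family of pairwise non-isomorphic algebras -/

section LowerBound

/-- The sequence `0, w + s 0, w + s 1, …`. -/
def offsetSeq {F E : Type*} [Field F] [Field E] [Algebra F E] (w : E) (s : ℕ → F) : ℕ → E
  | 0 => 0
  | i + 1 => w + algebraMap F E (s i)

/-- The sequence `0, 1, t, z 0, z 0 + 1, z 1, z 1 + 1, …`. -/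
def interleave {F : Type*} [Field F] (t : F) (z : ℕ → F) : ℕ → F
  | 0 => 0
  | 1 => 1
  | 2 => t
  | i + 3 => if i % 2 = 0 then z (i / 2) else z (i / 2) + 1

theorem interleave_even {F : Type*} [Field F] (t : F) (z : ℕ → F) (i : ℕ) :
    interleave t z (2 * i + 3) = z i := by
  simp [interleave]

theorem interleave_odd {F : Type*} [Field F] (t : F) (z : ℕ → F) (i : ℕ) :
    interleave t z (2 * i + 4) = z i + 1 := by
  have h1 : (2 * i + 1) % 2 = 1 := by omega
  have h2 : (2 * i + 1) / 2 = i := by omega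
  simp [interleave, h1, h2]

variable {F : Type u} [Field F] {E : Type u} [Field E] [Algebra F E]

theorem offsetSeq_not_mem_range {w : E} (hw : w ∉ Set.range (algebraMap F E)) (s : ℕ → F) (i : ℕ)
    (hi : 0 < i) : offsetSeq w s i ∉ Set.range (algebraMap F E) := by
  obtain ⟨i, rfl⟩ := Nat.exists_eq_add_of_le' hi
  rintro ⟨a, ha⟩
  exact hw ⟨a - s i, by rw [map_sub, ha, offsetSeq, add_sub_cancel_right]⟩

/-- The neighbours `z i` and `z i + 1` differ, so they cannot both equal the term at `l`; this is
why the two are interleaved. -/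
theorem exists_offsetSeq_ne (w : E) (t : F) (z : ℕ → F) (l : ℕ) :
    ∃ i, l < i ∧ offsetSeq w (interleave t z) i ≠ offsetSeq w (interleave t z) l := by
  by_contra! h
  have h1 := (h (2 * l + 4) (by omega)).trans (h (2 * l + 5) (by omega)).symm
  simp only [offsetSeq] at h1
  rw [interleave_even, interleave_odd, map_add, map_one] at h1
  have : (1 : E) = 0 := by linear_combination -h1
  exact one_ne_zero this

variable (p : ℕ) [hp : Fact p.Prime] [CharP F p]

/-- The thin Lie algebra attached to `w` and the sequence `interleave t z`. -/
noncomputable def thinAlg (w : E) (t : F) (z : ℕ → F) : LieAlgOver F where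
  carrier := genAlg (comp F p (offsetSeq w (interleave t z)))

variable (hE : Module.finrank F E = 2) {w : E} (hw : w ∉ Set.range (algebraMap F E))

include hE hw in
theorem isThinOfDimTwo_thinAlg (t : F) (z : ℕ → F) : (thinAlg p w t z).IsThinOfDimTwo := by
  have := charP_of_injective_algebraMap (algebraMap F E).injective p
  exact ⟨_, isThinGrading_comp hE (offsetSeq_not_mem_range hw _) (exists_offsetSeq_ne w t z) rfl,
    fun i hi => finrank_grading_comp hE (offsetSeq_not_mem_range hw _)
      (exists_offsetSeq_ne w t z) rfl hi⟩

include hE hw in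
theorem not_isMetabelian_thinAlg (t : F) (z : ℕ → F) : ¬ (thinAlg p w t z).IsMetabelian := by
  have := charP_of_injective_algebraMap (algebraMap F E).injective p
  refine derivedSeries_two_ne_bot hE (offsetSeq_not_mem_range hw _) (exists_offsetSeq_ne w t z) rfl ?_
  simp [offsetSeq, interleave]

include hE hw in
theorem eq_of_thinAlg_equiv {t : F} (ht : t = 0 ∨ t = 1 → ∀ z : F, z = 0 ∨ z = 1) {z z' : ℕ → F}
    (φ : (thinAlg p w t z).carrier ≃ₗ⁅F⁆ (thinAlg p w t z').carrier) : z = z' := by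
  have := charP_of_injective_algebraMap (algebraMap F E).injective p
  obtain ⟨ρ, a, b, c, d, h⟩ := exists_relation (p := p) hE (offsetSeq_not_mem_range hw _)
    (exists_offsetSeq_ne w t z) rfl (offsetSeq_not_mem_range hw _) (exists_offsetSeq_ne w t z') rfl
    φ (fun _ => rfl)
  have hs := eq_of_relation h ht rfl rfl rfl rfl rfl rfl
  funext i
  rw [← interleave_even t z, hs, interleave_even]

include hE in
theorem exists_not_mem_range_algebraMap : ∃ w : E, w ∉ Set.range (algebraMap F E) := by
  by_contra! h
  have := (Algebra.linearMap F E).finrank_range_add_finrank_ker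
  rw [(LinearMap.range_eq_top (f := Algebra.linearMap F E)).2 h, finrank_top, hE, Module.finrank_self] at this
  omega

include p hE in
theorem le_numIsoClasses_isThinOfDimTwo : Cardinal.lift.{u + 1, u} (#F ^ ℵ₀) ≤
    LieAlgOver.numIsoClasses (F := F) LieAlgOver.IsThinOfDimTwo := by
  obtain ⟨w, hw⟩ := exists_not_mem_range_algebraMap hE
  -- Take a third element of `F` if there is one; over the field of two elements any `t` will do.
  obtain ⟨t, ht⟩ : ∃ t : F, t = 0 ∨ t = 1 → ∀ z : F, z = 0 ∨ z = 1 := by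
    by_contra! h
    obtain ⟨-, z, hz⟩ := h 0
    rcases (h z).1 with h | h
    exacts [hz.1 h, hz.2 h]
  let f : ULift.{u + 1} (ℕ → F) → {c : Quotient (LieAlgOver.isoSetoid F) //
      ∃ L : LieAlgOver F, L.IsThinOfDimTwo ∧ Quotient.mk (LieAlgOver.isoSetoid F) L = c} :=
    fun z => ⟨_, thinAlg p w t z.down, isThinOfDimTwo_thinAlg p hE hw t z.down, rfl⟩
  have hf : Function.Injective f := fun z z' h => by
    obtain ⟨φ⟩ := Quotient.exact (s := LieAlgOver.isoSetoid F) (congrArg Subtype.val h)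
    exact ULift.down_injective (eq_of_thinAlg_equiv p hE hw ht φ)
  have := Cardinal.mk_le_of_injective hf
  rwa [Cardinal.mk_uLift, show #(ℕ → F) = #F ^ ℵ₀ by simp] at this

end LowerBound

end ThinLie

theorem mainTheorem3 {F : Type u} [Field F] (p : ℕ) [Fact p.Prime] [CharP F p]
    (E : Type v) [Field E] [Algebra F E] (hE : Module.finrank F E = 2) :
    LieAlgOver.numIsoClasses (F := F) LieAlgOver.IsThinOfDimTwo =
        Cardinal.lift.{u + 1, u} (#F ^ ℵ₀) ∧
      LieAlgOver.numIsoClasses (F := F) LieAlgOver.IsThin ≤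
        Cardinal.lift.{u + 1, u} (#F ^ ℵ₀) ∧
      ∃ L : LieAlgOver F, L.IsThinOfDimTwo ∧ ¬ L.IsMetabelian := by
  have hfin : FiniteDimensional F E := Module.finite_of_finrank_eq_succ hE
  -- The carriers counted live in the universe of `F`, so `E` is replaced by an isomorphic copy
  -- there, available because it is finite-dimensional.
  have hsmall : Small.{u} E := ⟨⟨_, ⟨(Module.finBasis F E).equivFun.toEquiv⟩⟩⟩
  have hE' : Module.finrank F (Shrink.{u} E) = 2 := by
    rw [← hE]
    exact (Shrink.algEquiv F E).toLinearEquiv.finrank_eq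
  obtain ⟨w, hw⟩ := ThinLie.exists_not_mem_range_algebraMap hE'
  refine ⟨le_antisymm ?_ (ThinLie.le_numIsoClasses_isThinOfDimTwo p hE'),
    ThinLie.numIsoClasses_isThin_le, ThinLie.thinAlg p w 0 0,
    ThinLie.isThinOfDimTwo_thinAlg p hE' hw 0 0, ThinLie.not_isMetabelian_thinAlg p hE' hw 0 0⟩
  refine le_trans ?_ ThinLie.numIsoClasses_isThin_le
  refine Cardinal.mk_subtype_mono ?_
  rintro c ⟨L, ⟨𝒜, h, -⟩, hLc⟩
  exact ⟨L, ⟨𝒜, h⟩, hLc⟩
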